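/- Let $E$ be a finite set and $\mathcal{L}\subseteq 2^E$. For $e\in E$ the toggle $t_e:\mathcal{L}\to\mathcal{L}$ is defined by $t_e(X)=X\cup\{e\}$ if $e\notin X$ and $X\cup\{e\}\in\mathcal{L}$, $t_e(X)=X\setminus\{e\}$ if $e\in X$ and $X\setminus\{e\}\in\mathcal{L}$, and $t_e(X)=X$ otherwise. Each $t_e$ is an involution, and the toggle group $T(\mathcal{L})$ is the subgroup of the symmetric group $\mathfrak{S}_{\mathcal{L}}$ generated by $\{t_e \mid e\in E\}$. Let $G$ be a finite simple graph with vertex set $V$. Let $\mathcal{VC}(G)\subseteq 2^{V}$ be the set of vertex covers of $G$, that is, of sets of vertices containing at least one endpoint of every edge of $G$. Then: (1) If $G$ is connected, $T(\mathcal{VC}(G))$ is either the whole symmetric group or the alternating group on the set $\mathcal{VC}(G)$. (2) If $G$ has connected components $G_1,\dots,G_k$, then $$T(\mathcal{VC}(G))\cong T(\mathcal{VC}(G_1))\times T(\mathcal{VC}(G_2))\times\cdots\times T(\mathcal{VC}(G_k)),$$ by an isomorphism that, for every $i$ and every vertex $v$ of $G_i$, sends the toggle $t_v\in T(\mathcal{VC}(G))$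 to the tuple whose $i$-th entry is the toggle $t_v\in T(\mathcal{VC}(G_i))$ and whose other entries are the identity. -/

import Mathlib

namespace ToggleGroup

variable {E : Type*}

open Classical in
/-- The toggle `t_e` of `e : E` on a family `L` of subsets of `E`, as a map `L → L`. -/
noncomputable def toggleFun (L : Set (Set E)) (e : E) (X : L) : L :=
  if h : e ∉ (X : Set E) ∧ (X : Set E) ∪ {e} ∈ L then ⟨(X : Set E) ∪ {e}, h.2⟩
  else if h : e ∈ (X : Set E) ∧ (X : Set E) \ {e} ∈ L then ⟨(X : Set E) \ {e}, h.2⟩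
  else X

theorem toggleFun_involutive (L : Set (Set E)) (e : E) :
    Function.Involutive (toggleFun L e) := by
  rintro ⟨X, hX⟩
  by_cases he : e ∈ X
  · by_cases h : X \ {e} ∈ L
    · have h1 : X \ {e} ∪ {e} = X := by
        rw [Set.sdiff_union_self, Set.union_eq_self_of_subset_right (by simpa using he)]
      have h2 : toggleFun L e ⟨X, hX⟩ = ⟨X \ {e}, h⟩ := by simp [toggleFun, he, h]
      rw [h2]
      unfold toggleFun
      rw [dif_pos ⟨by simp, by simpa only [h1] using hX⟩]
      exact Subtype.ext h1
    · simp [toggleFun, he, h]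
  · by_cases h : X ∪ {e} ∈ L
    · have h1 : (X ∪ {e}) \ {e} = X := by
        rw [Set.union_sdiff_right, Set.sdiff_singleton_eq_self he]
      have h2 : toggleFun L e ⟨X, hX⟩ = ⟨X ∪ {e}, h⟩ := by
        unfold toggleFun
        rw [dif_pos ⟨he, h⟩]
      rw [h2]
      unfold toggleFun
      rw [dif_neg (by simp), dif_pos ⟨by simp, by simpa only [h1] using hX⟩]
      exact Subtype.ext h1
    · have h2 : toggleFun L e ⟨X, hX⟩ = ⟨X, hX⟩ := by
        unfold toggleFun
        rw [dif_neg (fun k => h k.2), dif_neg (fun k => he k.1)]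
      rw [h2, h2]

/-- The toggle `t_e` as a permutation of the family `L`. -/
noncomputable def toggle (L : Set (Set E)) (e : E) : Equiv.Perm L :=
  (toggleFun_involutive L e).toPerm

/-- The (generalized) toggle group `T(L)`: the subgroup of the symmetric group on `L` generated
by all the toggles `t_e`, `e : E`. -/
def toggleGroup (L : Set (Set E)) : Subgroup (Equiv.Perm L) :=
  Subgroup.closure (Set.range (toggle L))

/-- The toggle `t_e`, as an element of the toggle group. -/
noncomputable def toggleGen (L : Set (Set E)) (e : E) : toggleGroup L :=
  ⟨toggle L e, Subgroup.subset_closure (Set.mem_range_self e)⟩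

/-- The family `VC(G)` of all vertex covers of the graph `G`. -/
def vertexCovers {V : Type*} (G : SimpleGraph V) : Set (Set V) :=
  {X | G.IsVertexCover X}

end ToggleGroup

/-! For (1), grow a vertex set `S` from one vertex to `V`, adding a vertex `v` adjacent to some `w ∈
S`, and keep two facts: the toggle group on `coversOn G S` is primitive and contains the alternating
group. The old family sits in the new one as the covers containing `v`, and makes up more than half
of it (`card_coversOn_insert_lt`), so primitivity passes to the new, transitive group. A cover
omitting `v` must keep `w`, so `t_w` fixes every new member and is the old `t_w` extended by the
identity (`viaEmbedding_toggle_coversOn`). With at least five old covers, simplicity of the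
alternating group turns this one element into all even permutations of the old family, and Jordan's
theorem on 3-cycles finishes. Otherwise `w` is adjacent to the rest of `S`, `t_w` is a
transposition, and primitivity gives the full symmetric group.

For (2), no edge joins two components, so `VC(G)` is the product of the families of the components
and each toggle acts on one coordinate. -/

namespace ToggleGroup

open Equiv.Perm MulAction

/-! ### Primitivity and alternating groups -/

section PermutationGroups

variable {α β : Type*}

/-- A subgroup of `Perm β` extending a primitive subgroup of `Perm α`, where `α` is more than half
of `β`, is primitive as soon as it is transitive. -/
theorem isPreprimitive_of_lift [Finite β] (ι : α ↪ β) (T : Subgroup (Equiv.Perm α))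
    (U : Subgroup (Equiv.Perm β)) (hlift : ∀ g ∈ T, ∃ h ∈ U, ∀ x, h (ι x) = ι (g x))
    (hU : IsPretransitive U β) (hT : IsPreprimitive T α) (hc : Nat.card β < 2 * Nat.card α) :
    IsPreprimitive U β := by
  choose! h hh using hlift
  -- The lifts are chosen arbitrarily; equivariance along a mere function `φ` suffices.
  let φ : T → U := fun g => ⟨h g, (hh g g.2).1⟩
  let f : α →ₑ[φ] β := ⟨ι, fun g x => ((hh g g.2).2 x).symm⟩
  refine IsPreprimitive.of_card_lt (f := f) ?_
  have : (Set.range f).ncard = Nat.card α := by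
    change (Set.range ι).ncard = _
    rw [← Set.image_univ, Set.ncard_image_of_injective _ ι.injective, Set.ncard_univ]
  rwa [this]

/-- A nontrivial subgroup normalized by the alternating group contains it. -/
theorem alternatingGroup_le_of_conj_mem [Fintype α] [DecidableEq α] (h5 : 5 ≤ Nat.card α)
    (K : Subgroup (Equiv.Perm α)) (hK : ∀ g ∈ alternatingGroup α, ∀ k ∈ K, g * k * g⁻¹ ∈ K)
    {k : Equiv.Perm α} (hk : k ∈ K) (hk1 : k ≠ 1) : alternatingGroup α ≤ K := by
  have := alternatingGroup.isSimpleGroup h5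
  let N : Subgroup (alternatingGroup α) := K.subgroupOf (alternatingGroup α)
  have hN : N.Normal := ⟨fun n hn g => hK g g.2 n hn⟩
  rcases hN.eq_bot_or_eq_top with h | h
  · exfalso
    -- Such a commutator is even and lies in `K`, so a trivial `N` forces `k` to centralize the
    -- alternating group.
    have hcomm : ∀ g ∈ alternatingGroup α, g * k * g⁻¹ * k⁻¹ = 1 := by
      intro g hg
      have h1 : g * k * g⁻¹ * k⁻¹ ∈ alternatingGroup α := by
        rw [mem_alternatingGroup]
        simp [mem_alternatingGroup.1 hg]
      have h2 : (⟨_, h1⟩ : alternatingGroup α) ∈ N := K.mul_mem (hK g hg k hk) (K.inv_mem hk)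
      rw [h, Subgroup.mem_bot] at h2
      exact congrArg Subtype.val h2
    obtain ⟨a, ha⟩ : ∃ a, k a ≠ a := by
      by_contra! hc
      exact hk1 (Equiv.ext hc)
    obtain ⟨b, hb, c, hc, hbc⟩ : ∃ b, b ∉ ({a, k a} : Finset α) ∧
        ∃ c, c ∉ ({a, k a} : Finset α) ∧ b ≠ c := by
      have h2 : 1 < (({a, k a} : Finset α)ᶜ).card := by
        rw [Finset.card_compl, ← Nat.card_eq_fintype_card]
        have := Finset.card_le_two (a := a) (b := k a)
        omega
      obtain ⟨b, hb, c, hc, hbc⟩ := Finset.one_lt_card.1 h2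
      exact ⟨b, Finset.mem_compl.1 hb, c, Finset.mem_compl.1 hc, hbc⟩
    simp only [Finset.mem_insert, Finset.mem_singleton, not_or] at hb hc
    -- This 3-cycle fixes `a` but moves `k a`, so it cannot commute with `k`.
    have h3 : (Equiv.swap (k a) b * Equiv.swap (k a) c).IsThreeCycle :=
      isThreeCycle_swap_mul_swap_same (Ne.symm hb.2) (Ne.symm hc.2) hbc
    have h4 := hcomm _ h3.mem_alternatingGroup
    rw [mul_inv_eq_one, mul_inv_eq_iff_eq_mul] at h4
    have h5 := DFunLike.congr_fun h4 a
    simp only [Equiv.Perm.mul_apply] at h5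
    rw [Equiv.swap_apply_left, Equiv.swap_apply_of_ne_of_ne hc.2 (Ne.symm hbc),
      Equiv.swap_apply_of_ne_of_ne (Ne.symm ha) (Ne.symm hc.1),
      Equiv.swap_apply_of_ne_of_ne (Ne.symm ha) (Ne.symm hb.1)] at h5
    exact hc.2 h5
  · exact Subgroup.subgroupOf_eq_top.1 h

/-- The permutations of `α` whose extension by the identity lies in `U` are normalized by `T`: a
lift of `g` preserves the range of `ι`, so conjugating an extension by it gives the extension of the
conjugate by `g`. As `k` is among them, so is every 3-cycle of `α`, and Jordan's theorem applies to
`U`. -/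
theorem alternatingGroup_le_of_lift [Fintype α] [DecidableEq α] [Fintype β] [DecidableEq β]
    (ι : α ↪ β) (T : Subgroup (Equiv.Perm α)) (U : Subgroup (Equiv.Perm β))
    (hlift : ∀ g ∈ T, ∃ h ∈ U, ∀ x, h (ι x) = ι (g x)) (hU : IsPreprimitive U β)
    (hT : alternatingGroup α ≤ T) (h5 : 5 ≤ Nat.card α) {k : Equiv.Perm α} (hk1 : k ≠ 1)
    (hk : k.viaEmbedding ι ∈ U) : alternatingGroup β ≤ U := by
  have hconj : ∀ g ∈ alternatingGroup α, ∀ k ∈ U.comap (viaEmbeddingHom ι),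
      g * k * g⁻¹ ∈ U.comap (viaEmbeddingHom ι) := by
    intro g hg k hk
    obtain ⟨h, hh, hx⟩ := hlift g (hT hg)
    have hrange : ∀ x, h⁻¹ (ι x) = ι (g⁻¹ x) := by
      intro x
      rw [Equiv.Perm.inv_eq_iff_eq, hx, Equiv.Perm.inv_def, Equiv.apply_symm_apply]
    have : viaEmbeddingHom ι (g * k * g⁻¹) = h * viaEmbeddingHom ι k * h⁻¹ := by
      ext y
      simp only [viaEmbeddingHom_apply, Equiv.Perm.mul_apply]
      by_cases hy : y ∈ Set.range ι
      · obtain ⟨x, rfl⟩ := hy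
        rw [viaEmbedding_apply, hrange, viaEmbedding_apply, hx]
        rfl
      · rw [viaEmbedding_apply_of_notMem _ _ _ hy, viaEmbedding_apply_of_notMem,
          Equiv.Perm.inv_def, Equiv.apply_symm_apply]
        rintro ⟨x, hxy⟩
        apply hy
        exact ⟨g x, by rw [← hx, hxy, Equiv.Perm.inv_def, Equiv.apply_symm_apply]⟩
    rw [Subgroup.mem_comap, this]
    exact U.mul_mem (U.mul_mem hh hk) (U.inv_mem hh)
  have hle := alternatingGroup_le_of_conj_mem h5 (U.comap (viaEmbeddingHom ι)) hconj
    (show k ∈ U.comap (viaEmbeddingHom ι) from hk) hk1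
  obtain ⟨a, b, c, hab, hac, hbc⟩ : ∃ a b c : α, a ≠ b ∧ a ≠ c ∧ b ≠ c := by
    have : 2 < Fintype.card α := by
      rw [← Nat.card_eq_fintype_card]
      omega
    exact Fintype.two_lt_card_iff.1 this
  have h3 := isThreeCycle_swap_mul_swap_same hab hac hbc
  refine alternatingGroup_le_of_isPreprimitive_of_isThreeCycle_mem hU ?_
    (hle h3.mem_alternatingGroup)
  classical
  rw [viaEmbeddingHom_apply]
  unfold viaEmbedding IsThreeCycle
  refine Eq.trans ?_ (show (Equiv.swap a b * Equiv.swap a c).cycleType = {3} from h3)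
  convert! cycleType_extendDomain (Equiv.ofInjective ι.1 ι.2)

theorem eq_top_or_eq_alternatingGroup [Fintype α] [DecidableEq α] {T : Subgroup (Equiv.Perm α)}
    (hT : alternatingGroup α ≤ T) : T = ⊤ ∨ T = alternatingGroup α := by
  rcases subsingleton_or_nontrivial α with h | h
  · exact Or.inl (Subsingleton.elim _ _)
  have h2 : T.index ∣ 2 := alternatingGroup.index_eq_two (α := α) ▸ Subgroup.index_dvd_of_le hT
  rcases (Nat.dvd_prime Nat.prime_two).1 h2 with h | h
  · exact Or.inl (Subgroup.index_eq_one.1 h)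
  · exact Or.inr (eq_alternatingGroup_of_index_eq_two h)

end PermutationGroups

end ToggleGroup

namespace ToggleGroup

/-! ### Splitting over connected components -/

section Components

theorem coe_toggle_of_notMem {E : Type*} {L : Set (Set E)} {e : E} {X : L}
    (he : e ∉ (X : Set E)) (h : (X : Set E) ∪ {e} ∈ L) :
    (toggle L e X : Set E) = (X : Set E) ∪ {e} := by
  change (toggleFun L e X : Set E) = _
  rw [toggleFun, dif_pos ⟨he, h⟩]

theorem coe_toggle_of_mem {E : Type*} {L : Set (Set E)} {e : E} {X : L}
    (he : e ∈ (X : Set E)) (h : (X : Set E) \ {e} ∈ L) :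
    (toggle L e X : Set E) = (X : Set E) \ {e} := by
  change (toggleFun L e X : Set E) = _
  rw [toggleFun, dif_neg (fun k => k.1 he), dif_pos ⟨he, h⟩]

theorem toggle_eq_self_of_mem {E : Type*} {L : Set (Set E)} {e : E} {X : L}
    (he : e ∈ (X : Set E)) (h : (X : Set E) \ {e} ∉ L) : toggle L e X = X := by
  change toggleFun L e X = _
  rw [toggleFun, dif_neg (fun k => k.1 he), dif_neg (fun k => h k.2)]

variable {V : Type*} (G : SimpleGraph V)

theorem isVertexCover_iff_forall_component (X : Set V) :
    G.IsVertexCover X ↔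
      ∀ C : G.ConnectedComponent, C.toSimpleGraph.IsVertexCover ((↑) ⁻¹' X : Set C) := by
  constructor
  · intro h C a b hab
    exact @h a b hab
  · intro h a b hab
    have hb : G.connectedComponentMk b = G.connectedComponentMk a :=
      SimpleGraph.ConnectedComponent.sound hab.symm.reachable
    exact @h (G.connectedComponentMk a) ⟨a, rfl⟩ ⟨b, hb⟩ hab

/-- A vertex cover of `G` amounts to a vertex cover of each connected component. -/
def vertexCoversEquivPi :
    vertexCovers G ≃ ((C : G.ConnectedComponent) → vertexCovers C.toSimpleGraph) where
  toFun X C := ⟨((↑) : C → V) ⁻¹' (X : Set V), (isVertexCover_iff_forall_component G X).1 X.2 C⟩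
  invFun Y := ⟨{v | (⟨v, rfl⟩ : G.connectedComponentMk v) ∈ (Y (G.connectedComponentMk v)).1}, by
    refine (isVertexCover_iff_forall_component G _).2 fun C => ?_
    have : (Y C : Set C) = ((↑) : C → V) ⁻¹'
        {v | (⟨v, rfl⟩ : G.connectedComponentMk v) ∈ (Y (G.connectedComponentMk v)).1} := by
      ext ⟨a, rfl⟩
      rfl
    exact this ▸ (Y C).2⟩
  left_inv X := rfl
  right_inv Y := by
    funext C
    apply Subtype.ext
    ext ⟨a, rfl⟩
    rfl

theorem coe_vertexCoversEquivPi (X : vertexCovers G) (C : G.ConnectedComponent) :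
    (vertexCoversEquivPi G X C : Set C) = (↑) ⁻¹' (X : Set V) := rfl

theorem vertexCoversEquivPi_toggle (C : G.ConnectedComponent) (v : C) (X : vertexCovers G) :
    vertexCoversEquivPi G (toggle (vertexCovers G) v X) C =
      toggle (vertexCovers C.toSimpleGraph) v (vertexCoversEquivPi G X C) := by
  apply Subtype.ext
  have h1 : (X : Set V) ∪ {(v : V)} ∈ vertexCovers G :=
    SimpleGraph.IsVertexCover.subset Set.subset_union_left X.2
  have h2 : ((↑) ⁻¹' (X : Set V) ∪ {v} : Set C) ∈ vertexCovers C.toSimpleGraph :=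
    SimpleGraph.IsVertexCover.subset Set.subset_union_left (vertexCoversEquivPi G X C).2
  -- Removing `v` can only uncover edges at `v`, all of which lie in `C`.
  have h3 : (X : Set V) \ {(v : V)} ∈ vertexCovers G ↔
      ((↑) ⁻¹' (X : Set V) \ {v} : Set C) ∈ vertexCovers C.toSimpleGraph := by
    constructor
    · intro h
      have h' := (isVertexCover_iff_forall_component G _).1 h C
      have he : ((↑) : C → V) ⁻¹' ((X : Set V) \ {(v : V)}) = (↑) ⁻¹' (X : Set V) \ {v} := by
        ext a
        simp [SetLike.coe_eq_coe]
      exact he ▸ h'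
    · intro h a b hab
      by_cases hC : G.connectedComponentMk a = C
      · have hb : G.connectedComponentMk b = C :=
          (SimpleGraph.ConnectedComponent.sound hab.symm.reachable).trans hC
        have := @h ⟨a, hC⟩ ⟨b, hb⟩ hab
        exact this.imp (fun k => ⟨k.1, fun e => k.2 (Subtype.ext e)⟩)
          (fun k => ⟨k.1, fun e => k.2 (Subtype.ext e)⟩)
      · have hb : G.connectedComponentMk b ≠ C := fun hb =>
          hC ((SimpleGraph.ConnectedComponent.sound hab.reachable).trans hb)
        have hv : G.connectedComponentMk (v : V) = C := v.2
        have := X.2 hab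
        grind
  rw [coe_vertexCoversEquivPi]
  by_cases hv : (v : V) ∈ (X : Set V)
  · by_cases h : (X : Set V) \ {(v : V)} ∈ vertexCovers G
    · rw [coe_toggle_of_mem hv h,
        coe_toggle_of_mem (X := vertexCoversEquivPi G X C) hv (h3.1 h), coe_vertexCoversEquivPi]
      ext a
      simp [SetLike.coe_eq_coe]
    · rw [toggle_eq_self_of_mem hv h, toggle_eq_self_of_mem
        (X := vertexCoversEquivPi G X C) hv (fun k => h (h3.2 k)),
        coe_vertexCoversEquivPi]
  · rw [coe_toggle_of_notMem hv h1, coe_toggle_of_notMem (X := vertexCoversEquivPi G X C) hv h2,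
      coe_vertexCoversEquivPi]
    ext a
    simp [SetLike.coe_eq_coe]

theorem vertexCoversEquivPi_toggle_of_ne (C D : G.ConnectedComponent) (v : C) (hD : D ≠ C)
    (X : vertexCovers G) :
    vertexCoversEquivPi G (toggle (vertexCovers G) v X) D = vertexCoversEquivPi G X D := by
  apply Subtype.ext
  have hv : ∀ a : D, (a : V) ≠ v := fun a h => by
    have h1 : G.connectedComponentMk (v : V) = C := v.2
    have h2 : G.connectedComponentMk (a : V) = D := a.2
    rw [h] at h2
    exact hD (h2.symm.trans h1)
  rw [coe_vertexCoversEquivPi, coe_vertexCoversEquivPi]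
  by_cases h1 : (v : V) ∈ (X : Set V)
  · by_cases h2 : (X : Set V) \ {(v : V)} ∈ vertexCovers G
    · rw [coe_toggle_of_mem h1 h2]
      ext a
      simp [hv a]
    · rw [toggle_eq_self_of_mem h1 h2]
  · rw [coe_toggle_of_notMem h1 (SimpleGraph.IsVertexCover.subset Set.subset_union_left X.2)]
    ext a
    simp [hv a]

/-- Permutations of the families of vertex covers of the components, acting together on the vertex
covers of `G`. -/
def piToggleGroupHom :
    ((C : G.ConnectedComponent) → toggleGroup (vertexCovers C.toSimpleGraph)) →*
      Equiv.Perm (vertexCovers G) where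
  toFun g := (vertexCoversEquivPi G).symm.permCongr
    (Equiv.piCongrRight fun C => (g C : Equiv.Perm (vertexCovers C.toSimpleGraph)))
  map_one' := by ext1; simp [Equiv.piCongrRight, Equiv.permCongr_apply]
  map_mul' g h := by ext1; simp [Equiv.piCongrRight, Equiv.permCongr_apply]; rfl

theorem vertexCoversEquivPi_piToggleGroupHom
    (g : (C : G.ConnectedComponent) → toggleGroup (vertexCovers C.toSimpleGraph))
    (X : vertexCovers G) (C : G.ConnectedComponent) :
    vertexCoversEquivPi G (piToggleGroupHom G g X) C =
      (g C : Equiv.Perm (vertexCovers C.toSimpleGraph)) (vertexCoversEquivPi G X C) := by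
  simp [piToggleGroupHom, Equiv.permCongr_apply]

theorem piToggleGroupHom_injective : Function.Injective (piToggleGroupHom G) := by
  classical
  intro g h hgh
  funext C
  apply Subtype.ext
  ext1 Y
  -- The full vertex set is a cover that fills the other coordinates.
  let Z : (D : G.ConnectedComponent) → vertexCovers D.toSimpleGraph :=
    Function.update (fun D => ⟨Set.univ, D.toSimpleGraph.isVertexCover_univ⟩) C Y
  have h1 := vertexCoversEquivPi_piToggleGroupHom G g ((vertexCoversEquivPi G).symm Z) C
  have h2 := vertexCoversEquivPi_piToggleGroupHom G h ((vertexCoversEquivPi G).symm Z) C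
  rw [hgh, h2] at h1
  simpa [Z] using h1.symm

theorem piToggleGroupHom_mulSingle [DecidableEq G.ConnectedComponent]
    (C : G.ConnectedComponent) (v : C) :
    piToggleGroupHom G (Pi.mulSingle C (toggleGen (vertexCovers C.toSimpleGraph) v)) =
      toggle (vertexCovers G) v := by
  ext1 X
  apply (vertexCoversEquivPi G).injective
  funext D
  rw [vertexCoversEquivPi_piToggleGroupHom]
  by_cases hD : D = C
  · subst hD
    rw [vertexCoversEquivPi_toggle, Pi.mulSingle_eq_same]
    rfl
  · rw [vertexCoversEquivPi_toggle_of_ne G C D v hD, Pi.mulSingle_eq_of_ne hD]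
    rfl

theorem range_piToggleGroupHom [Finite V] :
    (piToggleGroupHom G).range = toggleGroup (vertexCovers G) := by
  classical
  apply le_antisymm
  · have : Finite G.ConnectedComponent := Quot.finite _
    rw [MonoidHom.range_eq_map, Subgroup.map_le_iff_le_comap]
    intro g _
    -- A finite product is generated by its factors, and each factor by its toggles.
    refine Subgroup.pi_mem_of_mulSingle_mem g fun C => ?_
    obtain ⟨g, hg⟩ := g C
    change _ ∈ Subgroup.closure _ at hg
    refine Subgroup.closure_induction (p := fun x hx => (Pi.mulSingle C
      (⟨x, hx⟩ : toggleGroup (vertexCovers C.toSimpleGraph)) : ∀ C : G.ConnectedComponent,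
        toggleGroup (vertexCovers C.toSimpleGraph)) ∈
      (toggleGroup (vertexCovers G)).comap (piToggleGroupHom G)) ?_ ?_ ?_ ?_ hg
    · rintro _ ⟨v, rfl⟩
      rw [Subgroup.mem_comap]
      have := piToggleGroupHom_mulSingle G C v
      unfold toggleGen at this
      rw [this]
      exact Subgroup.subset_closure (Set.mem_range_self _)
    · rw [show (⟨1, one_mem _⟩ : toggleGroup (vertexCovers C.toSimpleGraph)) = 1 from rfl,
        Pi.mulSingle_one]
      exact Subgroup.one_mem _
    · intro x y hx hy h1 h2
      have := Subgroup.mul_mem _ h1 h2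
      rwa [← Pi.mulSingle_mul] at this
    · intro x hx h1
      have := Subgroup.inv_mem _ h1
      rwa [← Pi.mulSingle_inv] at this
  · refine (Subgroup.closure_le _).2 ?_
    rintro _ ⟨v, rfl⟩
    exact ⟨_, piToggleGroupHom_mulSingle G (G.connectedComponentMk v) ⟨v, rfl⟩⟩

/-- The toggle group of the vertex covers of `G` is the product of those of its components. -/
noncomputable def toggleGroupEquivPi [Finite V] :
    toggleGroup (vertexCovers G) ≃*
      ((C : G.ConnectedComponent) → toggleGroup (vertexCovers C.toSimpleGraph)) :=
  ((MonoidHom.ofInjective (piToggleGroupHom_injective G)).trans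
    (MulEquiv.subgroupCongr (range_piToggleGroupHom G))).symm

theorem toggleGroupEquivPi_toggleGen [Finite V] [DecidableEq G.ConnectedComponent]
    (C : G.ConnectedComponent) (v : C) :
    toggleGroupEquivPi G (toggleGen (vertexCovers G) (v : V)) =
      Pi.mulSingle C (toggleGen (vertexCovers C.toSimpleGraph) v) := by
  refine (MulEquiv.symm_apply_eq _).2 ?_
  apply Subtype.ext
  exact (piToggleGroupHom_mulSingle G C v).symm

end Components

end ToggleGroup

namespace ToggleGroup

open Equiv.Perm MulAction

/-! ### Connected graphs: growing the vertex set -/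

section Connected

variable {V : Type*} (G : SimpleGraph V)

/-- The vertex covers of `G` containing every vertex outside `S`: up to adding these vertices, the
vertex covers of the subgraph induced on `S`. -/
def coversOn (S : Set V) : Set (Set V) :=
  {X | G.IsVertexCover X ∧ Sᶜ ⊆ X}

variable {G}

theorem coversOn_univ : coversOn G Set.univ = vertexCovers G := by
  simp [coversOn, vertexCovers]

theorem coversOn_mono {S S' : Set V} (h : S ⊆ S') : coversOn G S ⊆ coversOn G S' :=
  fun _ hX => ⟨hX.1, (Set.compl_subset_compl.2 h).trans hX.2⟩

theorem mem_coversOn_of_subset {S X Y : Set V} (hX : X ∈ coversOn G S) (h : X ⊆ Y) :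
    Y ∈ coversOn G S :=
  ⟨hX.1.subset h, hX.2.trans h⟩

theorem univ_mem_coversOn (S : Set V) : Set.univ ∈ coversOn G S :=
  ⟨G.isVertexCover_univ, Set.subset_univ _⟩

theorem compl_singleton_mem_coversOn {S : Set V} {w : V} (hw : w ∈ S) :
    ({w}ᶜ : Set V) ∈ coversOn G S := by
  refine ⟨fun a b hab => ?_, by simpa using hw⟩
  have := hab.ne
  grind

/-- Supersets of covers are covers, so any cover reaches the full vertex set by toggling in its
missing vertices one at a time. -/
theorem isPretransitive_toggleGroup_coversOn [Finite V] (S : Set V) :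
    IsPretransitive (toggleGroup (coversOn G S)) (coversOn G S) := by
  rw [isPretransitive_iff_base (⟨Set.univ, univ_mem_coversOn S⟩ : coversOn G S)]
  suffices h : ∀ (n : ℕ) (X : coversOn G S), (X : Set V)ᶜ.ncard = n →
      ∃ g : toggleGroup (coversOn G S), g • (⟨Set.univ, univ_mem_coversOn S⟩ : coversOn G S) = X
    from fun X => h _ X rfl
  intro n
  induction n with
  | zero =>
    intro X hX
    refine ⟨1, Subtype.ext ?_⟩
    rw [Set.ncard_eq_zero, Set.compl_empty_iff] at hX
    rw [one_smul, hX]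
  | succ n ih =>
    intro X hX
    obtain ⟨e, he⟩ : (X : Set V)ᶜ.Nonempty := by
      rw [Set.nonempty_iff_ne_empty]
      intro h
      simp [h] at hX
    have hmem : (X : Set V) ∪ {e} ∈ coversOn G S :=
      mem_coversOn_of_subset X.2 Set.subset_union_left
    have hY := coe_toggle_of_notMem (L := coversOn G S) he hmem
    obtain ⟨g, hg⟩ := ih (toggle (coversOn G S) e X) (by
      rw [hY, Set.compl_union, ← Set.sdiff_eq, Set.ncard_sdiff_singleton_of_mem he, hX]
      rfl)
    refine ⟨toggleGen (coversOn G S) e * g, ?_⟩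
    rw [mul_smul, hg]
    exact toggleFun_involutive _ e X

theorem toggle_coversOn_of_notMem {S : Set V} {v : V} (hv : v ∉ S) :
    toggle (coversOn G S) v = 1 := by
  ext1 X
  exact toggle_eq_self_of_mem (X.2.2 hv) fun h => (h.2 hv).2 rfl

/-- The inclusion of the families of covers attached to a larger vertex set. -/
def coversOnInsert (v : V) (S : Set V) : coversOn G S ↪ coversOn G (insert v S) :=
  Set.embeddingOfSubset _ _ (coversOn_mono (Set.subset_insert v S))

theorem mem_range_coversOnInsert {v : V} {S : Set V} (hv : v ∉ S)
    (X : coversOn G (insert v S)) : X ∈ Set.range (coversOnInsert v S) ↔ v ∈ (X : Set V) := by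
  constructor
  · rintro ⟨Y, rfl⟩
    exact Y.2.2 hv
  · intro h
    refine ⟨⟨X, X.2.1, fun a ha => ?_⟩, rfl⟩
    by_cases hav : a = v
    · exact hav ▸ h
    · exact X.2.2 (by grind)

theorem toggle_coversOnInsert {v e : V} {S : Set V} (hv : v ∉ S) (he : e ≠ v)
    (X : coversOn G S) :
    toggle (coversOn G (insert v S)) e (coversOnInsert v S X) =
      coversOnInsert v S (toggle (coversOn G S) e X) := by
  have hvX : v ∈ (X : Set V) := X.2.2 hv
  by_cases heX : e ∈ (X : Set V)
  · have hiff : (X : Set V) \ {e} ∈ coversOn G (insert v S) ↔ (X : Set V) \ {e} ∈ coversOn G S := by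
      refine ⟨fun h => ⟨h.1, fun a ha => ?_⟩, fun h => coversOn_mono (Set.subset_insert v S) h⟩
      by_cases hav : a = v
      · rw [hav]
        exact ⟨hvX, fun h => he h.symm⟩
      · exact h.2 (by grind)
    by_cases h : (X : Set V) \ {e} ∈ coversOn G S
    · apply Subtype.ext
      rw [coe_toggle_of_mem (X := coversOnInsert v S X) heX (hiff.2 h)]
      exact (coe_toggle_of_mem heX h).symm
    · rw [toggle_eq_self_of_mem heX h,
        toggle_eq_self_of_mem (X := coversOnInsert v S X) heX (fun k => h (hiff.1 k))]
  · have h := mem_coversOn_of_subset X.2 (Set.subset_union_left (t := {e}))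
    apply Subtype.ext
    rw [coe_toggle_of_notMem (X := coversOnInsert v S X) heX
      (coversOn_mono (Set.subset_insert v S) h)]
    exact (coe_toggle_of_notMem heX h).symm

/-- Each `t_e` with `e ≠ v` lifts to `t_e`. The toggle `t_v` is trivial on the smaller family and
lifts to the identity, not to the larger family's `t_v`. -/
theorem exists_lift_coversOnInsert {v : V} {S : Set V} (hv : v ∉ S) :
    ∀ g ∈ toggleGroup (coversOn G S), ∃ h ∈ toggleGroup (coversOn G (insert v S)),
      ∀ X, h (coversOnInsert v S X) = coversOnInsert v S (g X) := by
  intro g hg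
  change g ∈ Subgroup.closure _ at hg
  induction hg using Subgroup.closure_induction with
  | mem g hg =>
    obtain ⟨e, rfl⟩ := hg
    by_cases he : e = v
    · refine ⟨1, one_mem _, fun X => ?_⟩
      rw [he, toggle_coversOn_of_notMem hv]
      rfl
    · exact ⟨_, (toggleGen _ e).2, toggle_coversOnInsert hv he⟩
  | one => exact ⟨1, one_mem _, fun _ => rfl⟩
  | mul a b _ _ ha hb =>
    obtain ⟨a', ha', hxa⟩ := ha
    obtain ⟨b', hb', hxb⟩ := hb
    exact ⟨a' * b', mul_mem ha' hb', fun X => by simp [hxa, hxb]⟩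
  | inv a _ ha =>
    obtain ⟨a', ha', hxa⟩ := ha
    refine ⟨a'⁻¹, inv_mem ha', fun X => ?_⟩
    rw [inv_eq_iff_eq, hxa, inv_def, Equiv.apply_symm_apply]

/-- Adding `v` injects the covers omitting `v` into those containing it. The cover `{w}ᶜ` is missed,
because a cover omitting `v` contains `w`; hence the strict inequality. -/
theorem card_coversOn_insert_lt [Finite V] {v w : V} {S : Set V} (hv : v ∉ S) (hw : w ∈ S)
    (hvw : G.Adj v w) :
    Nat.card (coversOn G (insert v S)) < 2 * Nat.card (coversOn G S) := by
  let R : Set (coversOn G (insert v S)) := Set.range (coversOnInsert v S)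
  have hR : R.ncard = Nat.card (coversOn G S) := by
    rw [← Set.ncard_univ, ← Set.ncard_image_of_injective _ (coversOnInsert v S).injective,
      Set.image_univ]
  let W : coversOn G (insert v S) :=
    ⟨{w}ᶜ, compl_singleton_mem_coversOn (Set.mem_insert_of_mem v hw)⟩
  have hW : W ∈ R := (mem_range_coversOnInsert hv W).2 hvw.ne
  have hlt : Rᶜ.ncard < R.ncard := by
    have h1 : Rᶜ.ncard ≤ (R \ {W}).ncard := by
      refine Set.ncard_le_ncard_of_injOn
        (fun X => ⟨X ∪ {v}, mem_coversOn_of_subset X.2 Set.subset_union_left⟩) ?_ ?_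
      · intro X hX
        have hX' : v ∉ (X : Set V) := fun h => hX ((mem_range_coversOnInsert hv X).2 h)
        refine ⟨(mem_range_coversOnInsert hv _).2 (Or.inr rfl), fun h => ?_⟩
        have h2 : (X : Set V) ∪ {v} = {w}ᶜ := congrArg Subtype.val h
        have h3 : w ∈ (X : Set V) := (X.2.1 hvw).resolve_left hX'
        exact (h2 ▸ Or.inl h3 : w ∈ ({w}ᶜ : Set V)) rfl
      · intro X hX Y hY hXY
        have hX' : v ∉ (X : Set V) := fun h => hX ((mem_range_coversOnInsert hv X).2 h)
        have hY' : v ∉ (Y : Set V) := fun h => hY ((mem_range_coversOnInsert hv Y).2 h)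
        have h2 : (X : Set V) ∪ {v} = (Y : Set V) ∪ {v} := congrArg Subtype.val hXY
        apply Subtype.ext
        rw [← Set.sdiff_singleton_eq_self hX', ← Set.sdiff_singleton_eq_self hY',
          ← Set.union_sdiff_right, h2, Set.union_sdiff_right]
    have h2 : (R \ {W}).ncard < R.ncard := Set.ncard_sdiff_singleton_lt_of_mem hW
    omega
  have := Set.ncard_add_ncard_compl R
  omega

theorem viaEmbedding_toggle_coversOn {v w : V} {S : Set V} (hv : v ∉ S) (hvw : G.Adj v w) :
    (toggle (coversOn G S) w).viaEmbedding (coversOnInsert v S) =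
      toggle (coversOn G (insert v S)) w := by
  ext1 X
  by_cases hX : X ∈ Set.range (coversOnInsert v S)
  · obtain ⟨Y, rfl⟩ := hX
    rw [viaEmbedding_apply, toggle_coversOnInsert hv hvw.ne']
  · rw [viaEmbedding_apply_of_notMem _ _ _ hX]
    have hX' : v ∉ (X : Set V) := fun h => hX ((mem_range_coversOnInsert hv X).2 h)
    symm
    refine toggle_eq_self_of_mem ((X.2.1 hvw).resolve_left hX') fun h => ?_
    rcases h.1 hvw with k | k
    · exact hX' k.1
    · exact k.2 rfl

theorem toggle_coversOn_univ {S : Set V} {w : V} (hw : w ∈ S) :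
    toggle (coversOn G S) w ⟨Set.univ, univ_mem_coversOn S⟩ =
      ⟨{w}ᶜ, compl_singleton_mem_coversOn hw⟩ := by
  have h : (Set.univ : Set V) \ {w} = {w}ᶜ := by rw [Set.compl_eq_univ_sdiff]
  apply Subtype.ext
  rw [coe_toggle_of_mem (Set.mem_univ w), h]
  rw [h]
  exact compl_singleton_mem_coversOn hw

/-- If `w` is adjacent to all other vertices of `S`, its toggle is a transposition. -/
theorem isSwap_toggle_coversOn {S : Set V} [DecidableEq (coversOn G S)] {w : V} (hw : w ∈ S)
    (hadj : ∀ u ∈ S, u ≠ w → G.Adj w u) : (toggle (coversOn G S) w).IsSwap := by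
  -- Omitting `w` forces all its neighbours in, so only one cover omits `w` and `t_w` can only
  -- exchange it with the full set.
  have hcompl : ∀ X ∈ coversOn G S, w ∉ X → X = {w}ᶜ := by
    intro X hX hwX
    ext u
    constructor
    · rintro hu rfl
      exact hwX hu
    · intro hu
      by_cases huS : u ∈ S
      · exact (hX.1 (hadj u huS hu)).resolve_left hwX
      · exact hX.2 huS
  have huniv := toggle_coversOn_univ (G := G) hw
  refine ⟨⟨Set.univ, univ_mem_coversOn S⟩, ⟨{w}ᶜ, compl_singleton_mem_coversOn hw⟩, ?_, ?_⟩
  · intro h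
    have h2 : (Set.univ : Set V) = {w}ᶜ := congrArg Subtype.val h
    exact (h2 ▸ Set.mem_univ w : w ∈ ({w}ᶜ : Set V)) rfl
  · ext1 X
    by_cases h1 : X = ⟨Set.univ, univ_mem_coversOn S⟩
    · rw [h1, Equiv.swap_apply_left, huniv]
    by_cases h2 : X = ⟨{w}ᶜ, compl_singleton_mem_coversOn hw⟩
    · rw [h2, Equiv.swap_apply_right, ← huniv]
      exact toggleFun_involutive _ w _
    rw [Equiv.swap_apply_of_ne_of_ne h1 h2]
    have hwX : w ∈ (X : Set V) := by
      by_contra h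
      exact h2 (Subtype.ext (hcompl X X.2 h))
    refine toggle_eq_self_of_mem hwX fun h => h1 (Subtype.ext ?_)
    have h3 := hcompl _ h fun k => k.2 rfl
    apply Set.eq_univ_of_forall
    intro u
    by_cases hu : u = w
    · exact hu ▸ hwX
    · exact (h3 ▸ hu : u ∈ (X : Set V) \ {w}).1

/-- The complements of the independent sets `∅`, `{u}`, `{w}`, `{x}`, `{u, w}` are five covers, just
enough for the alternating group to be simple. Here `x ≠ u` because only `x` is adjacent to `w`. -/
theorem five_le_card_coversOn [Finite V] {S : Set V} {u w x : V} (hu : u ∈ S) (hw : w ∈ S)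
    (hx : x ∈ S) (huw : u ≠ w) (hnadj : ¬ G.Adj w u) (hwx : G.Adj w x) :
    5 ≤ Nat.card (coversOn G S) := by
  have hxw : x ≠ w := hwx.ne'
  have hxu : x ≠ u := fun h => hnadj (h ▸ hwx)
  have hpair : ({u, w}ᶜ : Set V) ∈ coversOn G S := by
    refine ⟨fun a b hab => ?_, ?_⟩
    · have h1 := hab.ne
      have h2 : ¬ G.Adj u w := fun h => hnadj h.symm
      grind
    · rw [Set.compl_subset_compl]
      exact Set.insert_subset hu (Set.singleton_subset_iff.2 hw)
  let Z : Fin 5 → Set V := ![∅, {u}, {w}, {x}, {u, w}]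
  have hZ : ∀ i, (Z i)ᶜ ∈ coversOn G S := by
    intro i
    fin_cases i
    · simpa [Z] using univ_mem_coversOn S
    · exact compl_singleton_mem_coversOn hu
    · exact compl_singleton_mem_coversOn hw
    · exact compl_singleton_mem_coversOn hx
    · exact hpair
  have hinj : Function.Injective Z := by
    have key : ∀ i, (u ∈ Z i ↔ i = 1 ∨ i = 4) ∧ (w ∈ Z i ↔ i = 2 ∨ i = 4) ∧
        (x ∈ Z i ↔ i = 3) := by
      intro i
      fin_cases i <;> simp [Z, huw, hxw, hxu, huw.symm, hxw.symm, hxu.symm]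
    intro i j hij
    have h1 := key i
    have h2 := key j
    rw [hij] at h1
    have e1 := h1.1.symm.trans h2.1
    have e2 := h1.2.1.symm.trans h2.2.1
    have e3 := h1.2.2.symm.trans h2.2.2
    clear * - e1 e2 e3
    omega
  have hle := Nat.card_le_card_of_injective (fun i => (⟨(Z i)ᶜ, hZ i⟩ : coversOn G S))
    fun i j hij => hinj (compl_injective (congrArg Subtype.val hij))
  simpa using hle

theorem isPreprimitive_toggleGroup_coversOn_insert [Finite V] {v w : V} {S : Set V} (hv : v ∉ S)
    (hw : w ∈ S) (hvw : G.Adj v w)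
    (hS : IsPreprimitive (toggleGroup (coversOn G S)) (coversOn G S)) :
    IsPreprimitive (toggleGroup (coversOn G (insert v S))) (coversOn G (insert v S)) :=
  isPreprimitive_of_lift (coversOnInsert v S) _ _ (exists_lift_coversOnInsert hv)
    (isPretransitive_toggleGroup_coversOn _) hS (card_coversOn_insert_lt hv hw hvw)

theorem alternatingGroup_le_toggleGroup_coversOn_insert [Finite V] {v w : V} {S : Set V}
    [Fintype (coversOn G S)] [DecidableEq (coversOn G S)]
    [Fintype (coversOn G (insert v S))] [DecidableEq (coversOn G (insert v S))]
    (hv : v ∉ S) (hw : w ∈ S) (hvw : G.Adj v w)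
    (hnbr : ∀ u ∈ S, u ≠ w → ∃ x ∈ S, G.Adj w x)
    (hS : IsPreprimitive (toggleGroup (coversOn G S)) (coversOn G S))
    (hA : alternatingGroup (coversOn G S) ≤ toggleGroup (coversOn G S)) :
    alternatingGroup (coversOn G (insert v S)) ≤ toggleGroup (coversOn G (insert v S)) := by
  have hprim := isPreprimitive_toggleGroup_coversOn_insert hv hw hvw hS
  -- If `w` dominates `S`, it dominates `insert v S` and its toggle is a transposition. Otherwise a
  -- non-neighbour of `w`, with the neighbour from `hnbr`, yields five covers.
  by_cases hadj : ∀ u ∈ S, u ≠ w → G.Adj w u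
  · have hadj' : ∀ u ∈ insert v S, u ≠ w → G.Adj w u := by
      rintro u (rfl | hu) huw
      · exact hvw.symm
      · exact hadj u hu huw
    have hswap := isSwap_toggle_coversOn (Set.mem_insert_of_mem v hw) hadj'
    rw [subgroup_eq_top_of_isPreprimitive_of_isSwap_mem hprim _ hswap (toggleGen _ w).2]
    exact le_top
  · push Not at hadj
    obtain ⟨u, hu, huw, hnadj⟩ := hadj
    obtain ⟨x, hx, hwx⟩ := hnbr u hu huw
    refine alternatingGroup_le_of_lift (coversOnInsert v S) _ _ (exists_lift_coversOnInsert hv)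
      hprim hA (five_le_card_coversOn hu hw hx huw hnadj hwx) (k := toggle (coversOn G S) w) ?_ ?_
    · intro h
      have h1 := toggle_coversOn_univ (G := G) hw
      rw [h] at h1
      have h2 : (Set.univ : Set V) = {w}ᶜ := congrArg Subtype.val h1
      exact (h2 ▸ Set.mem_univ w : w ∈ ({w}ᶜ : Set V)) rfl
    · rw [viaEmbedding_toggle_coversOn hv hvw]
      exact (toggleGen _ w).2

theorem card_coversOn_singleton (a : V) : Nat.card (coversOn G {a}) = 2 := by
  have h : coversOn G {a} = {Set.univ, {a}ᶜ} := by
    ext X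
    constructor
    · intro hX
      by_cases ha : a ∈ X
      · left
        apply Set.eq_univ_of_forall
        intro u
        by_cases hu : u = a
        · exact hu ▸ ha
        · exact hX.2 hu
      · exact Or.inr ((Set.subset_compl_singleton_iff.2 ha).antisymm hX.2)
    · rintro (rfl | rfl)
      · exact univ_mem_coversOn _
      · exact compl_singleton_mem_coversOn rfl
  rw [h, Nat.card_coe_set_eq, Set.ncard_pair]
  intro h2
  exact (h2 ▸ Set.mem_univ a : a ∈ ({a}ᶜ : Set V)) rfl

theorem alternatingGroup_le_toggleGroup_vertexCovers [Finite V] [Fintype (vertexCovers G)]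
    [DecidableEq (vertexCovers G)] (hG : G.Connected) :
    alternatingGroup (vertexCovers G) ≤ toggleGroup (vertexCovers G) := by
  classical
  -- The adjacency clause says that no vertex of `S` is isolated in `S` unless `S` is a singleton;
  -- the extension step needs it.
  let good : Set (Set V) := {S | S.Nonempty ∧ (∀ w ∈ S, ∀ u ∈ S, u ≠ w → ∃ x ∈ S, G.Adj w x) ∧
    IsPreprimitive (toggleGroup (coversOn G S)) (coversOn G S) ∧
    ∀ [Fintype (coversOn G S)] [DecidableEq (coversOn G S)],
      alternatingGroup (coversOn G S) ≤ toggleGroup (coversOn G S)}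
  have hne : good.Nonempty := by
    obtain ⟨a⟩ := hG.nonempty
    refine ⟨{a}, Set.singleton_nonempty a, ?_, ?_, ?_⟩
    · rintro w rfl u rfl h
      exact (h rfl).elim
    · have := isPretransitive_toggleGroup_coversOn (G := G) {a}
      exact IsPreprimitive.of_prime_card (by rw [card_coversOn_singleton]; exact Nat.prime_two)
    · intro _ _
      rw [alternatingGroup.eq_bot_of_card_le_two (card_coversOn_singleton a).le]
      exact bot_le
  obtain ⟨S, hS⟩ := (Set.toFinite good).exists_maximal hne
  obtain ⟨⟨a, ha⟩, hnbr, hprim, halt⟩ := hS.prop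
  have hSuniv : S = Set.univ := by
    by_contra hS'
    obtain ⟨b, hb⟩ := (Set.ne_univ_iff_exists_notMem S).1 hS'
    obtain ⟨p⟩ := hG.preconnected a b
    -- A walk leaving `S` crosses an edge from `w ∈ S` to `v ∉ S`, and adding `v` contradicts
    -- maximality.
    obtain ⟨⟨⟨w, v⟩, hwv⟩, -, hw, hv⟩ := p.exists_boundary_dart S ha hb
    refine hv (hS.le_of_ge (y := insert v S) ⟨Set.insert_nonempty v S, ?_,
      isPreprimitive_toggleGroup_coversOn_insert hv hw hwv.symm hprim, ?_⟩
      (Set.subset_insert v S) (Set.mem_insert v S))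
    · rintro c (rfl | hc) u hu huc
      · exact ⟨w, Set.mem_insert_of_mem _ hw, hwv.symm⟩
      · by_cases hcw : c = w
        · exact ⟨v, Set.mem_insert v S, hcw ▸ hwv⟩
        · obtain ⟨x, hx, hcx⟩ := hnbr c hc w hw (Ne.symm hcw)
          exact ⟨x, Set.mem_insert_of_mem v hx, hcx⟩
    · intro _ _
      have := Fintype.ofFinite (coversOn G S)
      exact alternatingGroup_le_toggleGroup_coversOn_insert hv hw hwv.symm (hnbr w hw) hprim halt
  subst hSuniv
  revert halt
  rw [coversOn_univ]
  exact fun halt => halt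

end Connected

end ToggleGroup

theorem mainTheorem8 {V : Type*} [Finite V] (G : SimpleGraph V)
    [Fintype (ToggleGroup.vertexCovers G)] [DecidableEq (ToggleGroup.vertexCovers G)]
    [DecidableEq G.ConnectedComponent] :
    (G.Connected →
      ToggleGroup.toggleGroup (ToggleGroup.vertexCovers G) = ⊤ ∨
      ToggleGroup.toggleGroup (ToggleGroup.vertexCovers G) =
        alternatingGroup (ToggleGroup.vertexCovers G)) ∧
    (∃ φ : ToggleGroup.toggleGroup (ToggleGroup.vertexCovers G) ≃*
        ((C : G.ConnectedComponent) →
          ToggleGroup.toggleGroup (ToggleGroup.vertexCovers C.toSimpleGraph)),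
      ∀ (C : G.ConnectedComponent) (v : C),
        φ (ToggleGroup.toggleGen (ToggleGroup.vertexCovers G) (v : V)) =
          Pi.mulSingle C (ToggleGroup.toggleGen (ToggleGroup.vertexCovers C.toSimpleGraph) v)) :=
  ⟨fun hG => ToggleGroup.eq_top_or_eq_alternatingGroup
    (ToggleGroup.alternatingGroup_le_toggleGroup_vertexCovers hG),
    ToggleGroup.toggleGroupEquivPi G, ToggleGroup.toggleGroupEquivPi_toggleGen G⟩
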